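/- An ascent sequence of length $n$ is a sequence $x=x_1x_2\cdots x_n$ of nonnegative integers such that $x_1=0$ and, for each $2\le i\le n$, $x_i\le 1+\mathrm{asc}(x_1\cdots x_{i-1})$, where $\mathrm{asc}(s_1\cdots s_m)$ is the number of indices $1\le j\le m-1$ with $s_j<s_{j+1}$. The reduction $\mathrm{red}(w)$ of a word $w$ of nonnegative integers is obtained by replacing the $i$th smallest distinct letter of $w$ by $i-1$. The sequence $x$ contains a pattern $p=p_1\cdots p_k$ if $\mathrm{red}(x_{i_1}\cdots x_{i_k})=p$ for some indices $1\le i_1<\cdots<i_k\le n$; otherwise $x$ avoids $p$. For a finite set $P$ of patterns, let $a_P(n)$ be the number of ascent sequences of length $n$ that avoid every pattern in $P$. Theorem. For every $n\ge 1$, $$a_{\{0101,0102,0112\}}(n)=a_{\{0101,0102,0120\}}(n)=a_{\{0101,0102,0121\}}(n)=a_{\{0101,0112,0121\}}(n)=a_{\{0101,0120,0121\}}(n)=a_{\{0102,0120,0121\}}(n)=2^n-n.$$ -/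

import Mathlib

namespace AscentSeq

/-- The number of ascents of a sequence `s`: the number of (0-based) indices `j` such that
`j + 1` is still an index of `s` and `s_j < s_{j+1}`. -/
def asc (s : List ℕ) : ℕ :=
  ((Finset.range (s.length - 1)).filter (fun j => s.getD j 0 < s.getD (j + 1) 0)).card

/-- `x` is an ascent sequence: its first letter is `0`, and every later letter is at most one more
than the number of ascents of the prefix strictly before it. -/
def IsAscentSeq (x : List ℕ) : Prop :=
  (∀ h : 0 < x.length, x[0] = 0) ∧
    ∀ (i : ℕ) (h : i < x.length), 0 < i → x[i] ≤ 1 + asc (x.take i)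

/-- The reduction of a word `w`: the `i`-th smallest distinct letter of `w` is replaced by `i - 1`,
that is, each letter is replaced by the number of distinct letters of `w` smaller than it. -/
def red (w : List ℕ) : List ℕ :=
  w.map (fun a => (w.toFinset.filter (fun b => b < a)).card)

/-- `x` contains the pattern `p`: some (not necessarily contiguous) subsequence of `x`
has reduction `p`. -/
def Contains (x p : List ℕ) : Prop :=
  ∃ w : List ℕ, w.Sublist x ∧ red w = p

/-- `x` avoids the pattern `p`. -/
def Avoids (x p : List ℕ) : Prop := ¬ Contains x p

/-- The set of ascent sequences of length `n` that avoid every pattern in `P`. -/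
def avoiders (P : Finset (List ℕ)) (n : ℕ) : Set (List ℕ) :=
  {x | x.length = n ∧ IsAscentSeq x ∧ ∀ p ∈ P, Avoids x p}

/-- The number of ascent sequences of length `n` that avoid every pattern in `P`. -/
noncomputable def numAvoiders (P : Finset (List ℕ)) (n : ℕ) : ℕ := (avoiders P n).ncard

end AscentSeq

/-!
An ascent sequence that avoids `0101` or `0102` is a restricted growth function, and conversely
every restricted growth function is an ascent sequence (`avoiders_eq`): if a restricted growth
function ever has more ascents than its largest letter, then some ascent `a < b` ends in a letter
seen before, which produces `a b a b`; this is excluded by avoiding `0101`, and under avoidance of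
`0102` no letter larger than `b` may follow. So the task is to count restricted growth functions
avoiding the given patterns.

Four of the six pattern sets contain no pattern with two equal adjacent letters. For these,
avoidance depends only on the word left after collapsing adjacent repetitions, and there are
`(n - 1).choose (k - 1)` words of length `n` that collapse to a given word of length `k`
(`ncard_destutter_eq`). For each of these sets there are exactly two collapsed avoiders of every
length `k ≥ 3`, namely `0 1 ⋯ (k - 1)` and one word depending on the pattern set, and one each for
`k = 1, 2`. Summing the binomial coefficients gives `2 * 2 ^ (n - 1) - 1 - (n - 1) = 2 ^ n - n`
(`ncard_rgfAvoids_of_two_branches`).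

The two sets containing `0112` satisfy the recurrence `a (n + 1) = a n + (2 ^ n - 1)`. For `0101`,
`0102`, `0112`, removing a leading `0` from the words that begin with `00` leaves the words that
begin with `01`; these are the nonconstant restricted growth functions avoiding `001`, of which
there are `2 ^ n - 1` (`ncard_rgfAvoids001`). For `0101`, `0112`, `0121`, removing a final `0`
leaves the words with positive last letter; that letter either repeats its predecessor or is new,
and in the second case it follows one of the `2 ^ (n - 1)` restricted growth functions of length `n`
without repeated positive letters (`ncard_posAvoiders`).
-/

namespace AscentSeq

/-! ### Pattern containment as existence of sublists -/

lemma rank_lt_iff {w : List ℕ} {a b : ℕ} (ha : a ∈ w) :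
    (w.toFinset.filter (· < a)).card < (w.toFinset.filter (· < b)).card ↔ a < b := by
  constructor
  · intro h
    by_contra hab
    refine absurd (Finset.card_le_card ?_) h.not_ge
    intro c
    simp only [Finset.mem_filter]
    exact fun hc => ⟨hc.1, by omega⟩
  · intro h
    refine Finset.card_lt_card ((Finset.ssubset_iff_of_subset ?_).2 ⟨a, ?_, ?_⟩)
    · intro c
      simp only [Finset.mem_filter]
      exact fun hc => ⟨hc.1, by omega⟩
    · simp [ha, h]
    · simp

/-- The letters of a word of length four compare in the same way as those of its reduction. -/
lemma red_eq_four {w : List ℕ} {p q r s : ℕ} (h : red w = [p, q, r, s]) :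
    ∃ a b c d, w = [a, b, c, d] ∧ (a < b ↔ p < q) ∧ (b < a ↔ q < p) ∧ (a < c ↔ p < r) ∧
      (c < a ↔ r < p) ∧ (b < c ↔ q < r) ∧ (c < b ↔ r < q) ∧ (a < d ↔ p < s) ∧ (d < a ↔ s < p) ∧
      (b < d ↔ q < s) ∧ (d < b ↔ s < q) ∧ (c < d ↔ r < s) ∧ (d < c ↔ s < r) := by
  have hl : w.length = 4 := by simpa [red] using congrArg List.length h
  match w, hl with
  | [a, b, c, d], _ =>
    simp only [red, List.map_cons, List.map_nil, List.cons.injEq, and_true] at h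
    obtain ⟨rfl, rfl, rfl, rfl⟩ := h
    refine ⟨a, b, c, d, rfl, ?_, ?_, ?_, ?_, ?_, ?_, ?_, ?_, ?_, ?_, ?_, ?_⟩ <;>
      exact (rank_lt_iff (by simp)).symm

lemma contains_0101 {x : List ℕ} :
    Contains x [0, 1, 0, 1] ↔ ∃ a b, a < b ∧ [a, b, a, b].Sublist x := by
  constructor
  · rintro ⟨w, hw, h⟩
    obtain ⟨a, b, c, d, rfl, h⟩ := red_eq_four h
    obtain ⟨rfl, rfl⟩ : c = a ∧ d = b := by omega
    exact ⟨_, _, by omega, hw⟩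
  · rintro ⟨a, b, hab, hw⟩
    refine ⟨_, hw, ?_⟩
    simp [red, Finset.filter_insert, Finset.filter_singleton, hab, hab.not_gt]

lemma contains_0102 {x : List ℕ} :
    Contains x [0, 1, 0, 2] ↔ ∃ a b c, a < b ∧ b < c ∧ [a, b, a, c].Sublist x := by
  constructor
  · rintro ⟨w, hw, h⟩
    obtain ⟨a, b, c, d, rfl, h⟩ := red_eq_four h
    obtain rfl : c = a := by omega
    exact ⟨_, _, _, by omega, by omega, hw⟩
  · rintro ⟨a, b, c, hab, hbc, hw⟩
    refine ⟨_, hw, ?_⟩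
    have hac := hab.trans hbc
    simp [red, Finset.filter_insert, Finset.filter_singleton, hab, hab.not_gt, hbc, hbc.not_gt,
      hac, hac.not_gt, hab.ne, hab.ne']

lemma contains_0112 {x : List ℕ} :
    Contains x [0, 1, 1, 2] ↔ ∃ a b c, a < b ∧ b < c ∧ [a, b, b, c].Sublist x := by
  constructor
  · rintro ⟨w, hw, h⟩
    obtain ⟨a, b, c, d, rfl, h⟩ := red_eq_four h
    obtain rfl : c = b := by omega
    exact ⟨_, _, _, by omega, by omega, hw⟩
  · rintro ⟨a, b, c, hab, hbc, hw⟩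
    refine ⟨_, hw, ?_⟩
    have hac := hab.trans hbc
    simp [red, Finset.filter_insert, Finset.filter_singleton, hab, hab.not_gt, hbc, hbc.not_gt,
      hac, hac.not_gt, hab.ne]

lemma contains_0120 {x : List ℕ} :
    Contains x [0, 1, 2, 0] ↔ ∃ a b c, a < b ∧ b < c ∧ [a, b, c, a].Sublist x := by
  constructor
  · rintro ⟨w, hw, h⟩
    obtain ⟨a, b, c, d, rfl, h⟩ := red_eq_four h
    obtain rfl : d = a := by omega
    exact ⟨_, _, _, by omega, by omega, hw⟩
  · rintro ⟨a, b, c, hab, hbc, hw⟩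
    refine ⟨_, hw, ?_⟩
    have hac := hab.trans hbc
    simp [red, Finset.filter_insert, Finset.filter_singleton, hab, hab.not_gt, hbc, hbc.not_gt,
      hac, hac.not_gt, hab.ne, hab.ne']

lemma contains_0121 {x : List ℕ} :
    Contains x [0, 1, 2, 1] ↔ ∃ a b c, a < b ∧ b < c ∧ [a, b, c, b].Sublist x := by
  constructor
  · rintro ⟨w, hw, h⟩
    obtain ⟨a, b, c, d, rfl, h⟩ := red_eq_four h
    obtain rfl : d = b := by omega
    exact ⟨_, _, _, by omega, by omega, hw⟩
  · rintro ⟨a, b, c, hab, hbc, hw⟩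
    refine ⟨_, hw, ?_⟩
    have hac := hab.trans hbc
    simp [red, Finset.filter_insert, Finset.filter_singleton, hab, hab.not_gt, hbc, hbc.not_gt,
      hac, hac.not_gt, hab.ne]

lemma Avoids.of_sublist {x y p : List ℕ} (h : Avoids x p) (hyx : y.Sublist x) : Avoids y p :=
  fun ⟨w, hw, hp⟩ => h ⟨w, hw.trans hyx, hp⟩

lemma append_singleton_sublist_append_singleton {w x : List ℕ} {c v : ℕ} :
    (w ++ [c]).Sublist (x ++ [v]) ↔ (w ++ [c]).Sublist x ∨ c = v ∧ w.Sublist x := by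
  rw [← List.reverse_sublist, ← List.reverse_sublist (l₁ := w ++ [c]),
    ← List.reverse_sublist (l₁ := w)]
  simp only [List.reverse_append, List.reverse_cons, List.reverse_nil, List.nil_append,
    List.singleton_append]
  constructor
  · intro h
    cases h with
    | cons _ h => exact .inl h
    | cons_cons _ h => exact .inr ⟨rfl, h⟩
  · rintro (h | ⟨rfl, h⟩)
    · exact h.cons _
    · exact h.cons_cons _

lemma four_sublist_snoc {x : List ℕ} {a b c d v : ℕ} :
    [a, b, c, d].Sublist (x ++ [v]) ↔ [a, b, c, d].Sublist x ∨ d = v ∧ [a, b, c].Sublist x :=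
  append_singleton_sublist_append_singleton (w := [a, b, c])

lemma three_sublist_snoc {x : List ℕ} {a b c v : ℕ} :
    [a, b, c].Sublist (x ++ [v]) ↔ [a, b, c].Sublist x ∨ c = v ∧ [a, b].Sublist x :=
  append_singleton_sublist_append_singleton (w := [a, b])

lemma two_sublist_snoc {x : List ℕ} {a b v : ℕ} :
    [a, b].Sublist (x ++ [v]) ↔ [a, b].Sublist x ∨ b = v ∧ a ∈ x := by
  rw [← List.singleton_sublist (a := a)]
  exact append_singleton_sublist_append_singleton (w := [a])

/-! ### Restricted growth functions -/

/-- A restricted growth function: every letter is preceded by all the smaller letters. -/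
def IsRGF (x : List ℕ) : Prop :=
  ∀ u v t, x = u ++ v :: t → ∀ j < v, j ∈ u

lemma isRGF_nil : IsRGF [] := by
  intro u v t h
  simp at h

lemma isRGF_snoc {x : List ℕ} {v : ℕ} :
    IsRGF (x ++ [v]) ↔ IsRGF x ∧ ∀ j < v, j ∈ x := by
  constructor
  · intro h
    exact ⟨fun u w t hx => h u w (t ++ [v]) (by simp [hx]), h x v [] rfl⟩
  · rintro ⟨h, hv⟩ u w t hx
    rcases List.eq_nil_or_concat t with rfl | ⟨t, z, rfl⟩
    · obtain ⟨rfl, h2⟩ := List.append_inj' hx rfl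
      obtain rfl : v = w := by simpa using h2
      exact hv
    · have hx' : x ++ [v] = (u ++ w :: t) ++ [z] := by simpa using hx
      exact h u w t (List.append_inj' hx' rfl).1

/-- In a restricted growth function, any sublist may be extended on the left by a letter smaller
than its first one. -/
lemma IsRGF.cons_sublist {x t : List ℕ} {a b : ℕ} (hx : IsRGF x) (hab : a < b)
    (h : (b :: t).Sublist x) : (a :: b :: t).Sublist x := by
  obtain ⟨r, s, rfl, hr, hs⟩ := List.cons_sublist_iff.1 h
  obtain ⟨p, q, rfl⟩ := List.append_of_mem hr
  have ha := hx p b (q ++ s) (by simp) a hab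
  have h1 : [a].Sublist p := List.singleton_sublist.2 ha
  have h2 : [b].Sublist (b :: q) := by simp
  simpa using (h1.append h2).append hs

lemma IsRGF.mem_of_lt {x : List ℕ} {a b : ℕ} (hx : IsRGF x) (hab : a < b) (hb : b ∈ x) : a ∈ x :=
  (hx.cons_sublist hab (List.singleton_sublist.2 hb)).subset (by simp)

lemma IsRGF.head_eq_zero {a : ℕ} {t : List ℕ} (h : IsRGF (a :: t)) : a = 0 := by
  by_contra ha
  simpa using h [] a t rfl 0 (by omega)

lemma isRGF_zero_cons {x : List ℕ} :
    IsRGF (0 :: x) ↔ ∀ u v t, x = u ++ v :: t → ∀ j < v, j = 0 ∨ j ∈ u := by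
  constructor
  · intro h u v t hx j hj
    simpa using h (0 :: u) v t (by simp [hx]) j hj
  · intro h u v t hx j hj
    cases u with
    | nil =>
      simp at hx
      omega
    | cons c u =>
      simp only [List.cons_append, List.cons.injEq] at hx
      obtain ⟨rfl, hx⟩ := hx
      simpa using h u v t hx j hj

lemma isRGF_zero_cons_map_succ {x : List ℕ} : IsRGF (0 :: x.map Nat.succ) ↔ IsRGF x := by
  rw [isRGF_zero_cons]
  constructor
  · rintro h u v t rfl j hj
    simpa using h (u.map Nat.succ) (v + 1) (t.map Nat.succ) (by simp) (j + 1) (by omega)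
  · intro h u v t hx j hj
    obtain ⟨u', w, rfl, rfl, hw⟩ := List.map_eq_append_iff.1 hx
    obtain ⟨v', t', rfl, rfl, rfl⟩ := List.map_eq_cons_iff.1 hw
    rcases j with _ | j
    · exact .inl rfl
    · right
      simpa using h u' v' t' rfl j (by omega)

lemma isRGF_zero_cons_zero_cons {x : List ℕ} : IsRGF (0 :: 0 :: x) ↔ IsRGF (0 :: x) := by
  rw [isRGF_zero_cons, isRGF_zero_cons]
  constructor
  · rintro h u v t rfl j hj
    have := h (0 :: u) v t (by simp) j hj
    simp only [List.mem_cons] at this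
    tauto
  · intro h u v t hx j hj
    cases u with
    | nil =>
      simp at hx
      omega
    | cons c u =>
      simp only [List.cons_append, List.cons.injEq] at hx
      have := h u v t hx.2 j hj
      simp only [List.mem_cons]
      tauto

/-! ### Ascent sequences and restricted growth functions -/

lemma asc_snoc (x : List ℕ) (l v : ℕ) :
    asc (x ++ [l] ++ [v]) = asc (x ++ [l]) + if l < v then 1 else 0 := by
  have h : ∀ j ∈ Finset.range x.length,
      ((x ++ [l] ++ [v]).getD j 0 < (x ++ [l] ++ [v]).getD (j + 1) 0 ↔
        (x ++ [l]).getD j 0 < (x ++ [l]).getD (j + 1) 0) := by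
    intro j hj
    rw [Finset.mem_range] at hj
    rw [List.getD_append (x ++ [l]) [v] 0 j (by simp; omega),
      List.getD_append (x ++ [l]) [v] 0 (j + 1) (by simp; omega)]
  unfold asc
  have h1 : (x ++ [l] ++ [v]).length - 1 = x.length + 1 := by simp
  have h2 : (x ++ [l]).length - 1 = x.length := by simp
  rw [h1, h2, Finset.range_add_one, Finset.filter_insert, Finset.filter_congr h]
  have h3 : (x ++ [l] ++ [v]).getD x.length 0 = l := by simp
  have h4 : (x ++ [l] ++ [v]).getD (x.length + 1) 0 = v := by simp
  rw [h3, h4]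
  split_ifs with hlv
  · rw [Finset.card_insert_of_notMem (by simp)]
  · rfl

lemma asc_singleton (v : ℕ) : asc [v] = 0 := by simp [asc]

lemma isAscentSeq_nil : IsAscentSeq [] := by simp [IsAscentSeq]

lemma isAscentSeq_singleton {v : ℕ} : IsAscentSeq [v] ↔ v = 0 := by
  simp only [IsAscentSeq]
  constructor
  · intro h
    simpa using h.1
  · rintro rfl
    refine ⟨by simp, fun i h hi => ?_⟩
    simp at h
    omega

lemma isAscentSeq_snoc {x : List ℕ} {v : ℕ} (hx : x ≠ []) :
    IsAscentSeq (x ++ [v]) ↔ IsAscentSeq x ∧ v ≤ 1 + asc x := by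
  have hpos : 0 < x.length := List.length_pos_iff.2 hx
  constructor
  · rintro ⟨h0, h⟩
    refine ⟨⟨fun hp => ?_, fun i hi hi0 => ?_⟩, ?_⟩
    · simpa [List.getElem_append_left hp] using h0 (by simp)
    · have := h i (by simp; omega) hi0
      rwa [List.getElem_append_left hi, List.take_append_of_le_length hi.le] at this
    · simpa using h x.length (by simp) hpos
  · rintro ⟨⟨h0, h⟩, hv⟩
    refine ⟨fun hp => ?_, fun i hi hi0 => ?_⟩
    · simpa [List.getElem_append_left hpos] using h0 hpos
    · rcases Nat.lt_or_ge i x.length with hlt | hge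
      · rw [List.getElem_append_left hlt, List.take_append_of_le_length hlt.le]
        exact h i hlt hi0
      · obtain rfl : i = x.length := by
          simp at hi
          omega
        simpa using hv

lemma IsRGF.le_asc {x : List ℕ} (hx : IsRGF x) : ∀ m ∈ x, m ≤ asc x := by
  induction x using List.reverseRecOn with
  | nil => simp
  | append_singleton x w ih =>
    obtain ⟨hx', hw⟩ := isRGF_snoc.1 hx
    rcases List.eq_nil_or_concat x with rfl | ⟨y, l, rfl⟩
    · obtain rfl : w = 0 := hx.head_eq_zero
      simp
    · rw [List.concat_eq_append] at *
      intro m hm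
      rw [asc_snoc]
      rw [List.mem_append, List.mem_singleton] at hm
      rcases hm with hm | rfl
      · exact (ih hx' m hm).trans (Nat.le_add_right _ _)
      · have hl := ih hx' l (by simp)
        split_ifs with hlm
        · have := ih hx' (m - 1) (hw _ (by omega))
          omega
        · omega

/-- A restricted growth function either contains `0101` or has as many ascents as its largest
letter indicates: an ascent `l < w` to a letter `w` seen before comes after an earlier `l`
preceding the first `w`. -/
lemma IsRGF.exists_sublist_or_asc_mem {x : List ℕ} (hx : IsRGF x) (hne : x ≠ []) :
    (∃ a b, a < b ∧ [a, b, a, b].Sublist x) ∨ asc x ∈ x := by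
  induction x using List.reverseRecOn with
  | nil => exact absurd rfl hne
  | append_singleton x w ih =>
    obtain ⟨hx', hw⟩ := isRGF_snoc.1 hx
    rcases List.eq_nil_or_concat x with rfl | ⟨y, l, rfl⟩
    · obtain rfl : w = 0 := hx.head_eq_zero
      right
      simp [asc_singleton]
    rw [List.concat_eq_append] at *
    rcases ih hx' (by simp) with ⟨a, b, hab, h⟩ | hasc
    · exact .inl ⟨a, b, hab, h.trans (List.sublist_append_left _ _)⟩
    rw [asc_snoc]
    split_ifs with hlw
    · by_cases hwx : w ∈ y ++ [l]
      · left
        refine ⟨l, w, hlw, four_sublist_snoc.2 (.inr ⟨rfl, ?_⟩)⟩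
        refine hx'.cons_sublist hlw (two_sublist_snoc.2 (.inr ⟨rfl, ?_⟩))
        simpa [hlw.ne'] using hwx
      · right
        have h1 : asc (y ++ [l]) < w := by
          by_contra hle
          rcases (not_lt.1 hle).lt_or_eq with h | h
          · exact hwx (hx'.mem_of_lt h hasc)
          · exact hwx (h ▸ hasc)
        have h2 : w ≤ asc (y ++ [l]) + 1 := by
          by_contra hlt
          have := hx'.le_asc _ (hw (asc (y ++ [l]) + 1) (by omega))
          omega
        simp [show asc (y ++ [l]) + 1 = w by omega]
    · right
      simp only [add_zero, List.mem_append] at hasc ⊢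
      tauto

lemma IsRGF.isAscentSeq {x : List ℕ} (hx : IsRGF x) : IsAscentSeq x := by
  induction x using List.reverseRecOn with
  | nil => exact isAscentSeq_nil
  | append_singleton x w ih =>
    obtain ⟨hx', hw⟩ := isRGF_snoc.1 hx
    by_cases hne : x = []
    · subst hne
      exact isAscentSeq_singleton.2 hx.head_eq_zero
    · refine (isAscentSeq_snoc hne).2 ⟨ih hx', ?_⟩
      by_contra hlt
      have := hx'.le_asc (asc x + 1) (hw _ (by omega))
      omega

lemma IsAscentSeq.isRGF {x : List ℕ} (hx : IsAscentSeq x)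
    (h : Avoids x [0, 1, 0, 1] ∨ Avoids x [0, 1, 0, 2]) : IsRGF x := by
  induction x using List.reverseRecOn with
  | nil => exact isRGF_nil
  | append_singleton x w ih =>
    by_cases hne : x = []
    · subst hne
      obtain rfl := isAscentSeq_singleton.1 hx
      exact isRGF_snoc.2 ⟨isRGF_nil, by simp⟩
    obtain ⟨hx', hw⟩ := (isAscentSeq_snoc hne).1 hx
    have hs := List.sublist_append_left x [w]
    have hr := ih hx' (h.imp (·.of_sublist hs) (·.of_sublist hs))
    refine isRGF_snoc.2 ⟨hr, fun j hj => ?_⟩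
    rcases hr.exists_sublist_or_asc_mem hne with ⟨a, b, hab, hsub⟩ | hasc
    · rcases h with h | h
      · exact absurd (contains_0101.2 ⟨a, b, hab, hsub.trans hs⟩) h
      · -- a letter exceeding `b` would complete an occurrence of `0102`
        have hwb : w ≤ b := by
          by_contra hlt
          refine h (contains_0102.2 ⟨a, b, w, hab, by omega, four_sublist_snoc.2 (.inr ⟨rfl, ?_⟩)⟩)
          exact (List.sublist_append_left [a, b, a] [b]).trans hsub
        exact hr.mem_of_lt (hj.trans_le hwb) (hsub.subset (by simp))
    · rcases (show j ≤ asc x by omega).lt_or_eq with h | rfl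
      · exact hr.mem_of_lt h hasc
      · exact hasc

/-- The restricted growth functions that avoid every pattern in `P`. -/
def RGFAvoids (P : Finset (List ℕ)) (x : List ℕ) : Prop :=
  IsRGF x ∧ ∀ p ∈ P, Avoids x p

lemma avoiders_eq {P : Finset (List ℕ)} (hP : [0, 1, 0, 1] ∈ P ∨ [0, 1, 0, 2] ∈ P) (n : ℕ) :
    avoiders P n = {x | x.length = n ∧ RGFAvoids P x} := by
  ext x
  simp only [avoiders, RGFAvoids, Set.mem_ofPred_eq]
  refine and_congr_right fun _ => and_congr_left fun h => ⟨fun hx => ?_, IsRGF.isAscentSeq⟩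
  exact hx.isRGF (hP.imp (h _) (h _))

lemma IsRGF.lt_length {x : List ℕ} (hx : IsRGF x) : ∀ v ∈ x, v < x.length := by
  induction x using List.reverseRecOn with
  | nil => simp
  | append_singleton x w ih =>
    obtain ⟨hx', hw⟩ := isRGF_snoc.1 hx
    intro v hv
    rw [List.mem_append, List.mem_singleton] at hv
    rw [List.length_append, List.length_singleton]
    rcases hv with hv | rfl
    · exact (ih hx' v hv).trans (Nat.lt_succ_self _)
    · rcases v with _ | v
      · omega
      · have := ih hx' v (hw v (by omega))
        omega

lemma finite_lists_lt (n N : ℕ) : {x : List ℕ | x.length = n ∧ ∀ v ∈ x, v < N}.Finite := by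
  induction n with
  | zero => exact (Set.finite_singleton []).subset fun x hx => by simpa using hx.1
  | succ n ih =>
    refine ((Set.finite_Iio N).image2 List.cons ih).subset ?_
    rintro x ⟨hl, hx⟩
    match x with
    | a :: x =>
      exact ⟨a, hx a (by simp), x, ⟨by simpa using hl, fun v hv => hx v (by simp [hv])⟩, rfl⟩

lemma finite_rgf (n : ℕ) : {x : List ℕ | x.length = n ∧ IsRGF x}.Finite :=
  (finite_lists_lt n n).subset fun _ hx => ⟨hx.1, fun v hv => hx.1 ▸ hx.2.lt_length v hv⟩

/-! ### Removing adjacent repetitions -/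

lemma sublist_cons_of_isChain_ne {w l : List ℕ} {a : ℕ} (hw : w.IsChain (· ≠ ·))
    (h : w.Sublist (a :: a :: l)) : w.Sublist (a :: l) := by
  cases h with
  | cons _ h => exact h
  | cons_cons _ h =>
    cases h with
    | cons _ h => exact h.cons_cons _
    | cons_cons _ h => exact absurd rfl (List.isChain_cons_cons.1 hw).1

lemma sublist_destutter'_of_isChain_ne {w x : List ℕ} {a : ℕ} (hw : w.IsChain (· ≠ ·))
    (h : w.Sublist (a :: x)) : w.Sublist (x.destutter' (· ≠ ·) a) := by
  induction x generalizing a w with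
  | nil => simpa using h
  | cons b x ih =>
    rw [List.destutter'_cons]
    split_ifs with hab
    · cases h with
      | cons _ h => exact (ih hw h).cons _
      | cons_cons _ h => exact (ih hw.tail h).cons_cons _
    · obtain rfl : a = b := not_not.1 hab
      exact ih hw (sublist_cons_of_isChain_ne hw h)

lemma contains_destutter {x p : List ℕ} (hp : p.IsChain (· ≠ ·)) :
    Contains (x.destutter (· ≠ ·)) p ↔ Contains x p := by
  constructor
  · rintro ⟨w, hw, h⟩
    exact ⟨w, hw.trans (List.destutter_sublist _ _), h⟩
  · rintro ⟨w, hw, rfl⟩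
    refine ⟨w, ?_, rfl⟩
    cases x with
    | nil => simpa using hw
    | cons a x =>
      refine sublist_destutter'_of_isChain_ne ?_ hw
      exact ((List.isChain_map _).1 hp).imp fun a b hab h => hab (by rw [h])

lemma isRGF_append_cons_cons_self {u x : List ℕ} {a : ℕ} :
    IsRGF (u ++ a :: a :: x) ↔ IsRGF (u ++ a :: x) := by
  induction x using List.reverseRecOn with
  | nil =>
    rw [show u ++ [a, a] = u ++ [a] ++ [a] by simp, isRGF_snoc (x := u ++ [a])]
    refine and_iff_left_of_imp fun h j hj => ?_
    simp [(isRGF_snoc.1 h).2 j hj]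
  | append_singleton x w ih =>
    rw [show u ++ a :: a :: (x ++ [w]) = (u ++ a :: a :: x) ++ [w] by simp,
      show u ++ a :: (x ++ [w]) = (u ++ a :: x) ++ [w] by simp, isRGF_snoc, isRGF_snoc, ih]
    simp

lemma isRGF_append_destutter' {u x : List ℕ} {a : ℕ} :
    IsRGF (u ++ x.destutter' (· ≠ ·) a) ↔ IsRGF (u ++ a :: x) := by
  induction x generalizing a u with
  | nil => simp
  | cons b x ih =>
    rw [List.destutter'_cons]
    split_ifs with hab
    · simpa using ih (u := u ++ [a]) (a := b)
    · obtain rfl : a = b := not_not.1 hab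
      rw [ih, isRGF_append_cons_cons_self]

lemma rgfAvoids_destutter {P : Finset (List ℕ)} (hP : ∀ p ∈ P, p.IsChain (· ≠ ·)) {x : List ℕ} :
    RGFAvoids P (x.destutter (· ≠ ·)) ↔ RGFAvoids P x := by
  refine and_congr ?_ (forall₂_congr fun p hp => not_congr (contains_destutter (hP p hp)))
  cases x with
  | nil => simp
  | cons a x =>
    rw [List.destutter_cons']
    exact isRGF_append_destutter' (u := [])

lemma exists_destutter'_eq_cons (x : List ℕ) (a : ℕ) :
    ∃ l, x.destutter' (· ≠ ·) a = a :: l := by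
  induction x with
  | nil => exact ⟨[], rfl⟩
  | cons b x ih =>
    rw [List.destutter'_cons]
    split_ifs
    · exact ⟨_, rfl⟩
    · exact ih

lemma finite_destutter_eq (n : ℕ) (w : List ℕ) :
    {x : List ℕ | x.length = n ∧ x.destutter (· ≠ ·) = w}.Finite := by
  refine (finite_lists_lt n (w.sum + 1)).subset fun x hx => ⟨hx.1, fun v hv => ?_⟩
  refine Nat.lt_succ_of_le (List.le_sum_of_mem ?_)
  obtain ⟨-, rfl⟩ := hx
  cases x with
  | nil => simp at hv
  | cons a x =>
    have := sublist_destutter'_of_isChain_ne (List.isChain_singleton v) (List.singleton_sublist.2 hv)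
    exact this.subset (by simp)

/-- The words of length `n + 1` whose adjacent repetitions collapse to a given word correspond to
compositions of `n + 1` with as many parts as that word has letters. -/
lemma ncard_destutter_eq (n : ℕ) (a : ℕ) (w : List ℕ) (hw : (a :: w).IsChain (· ≠ ·)) :
    {x : List ℕ | x.length = n + 1 ∧ x.destutter (· ≠ ·) = a :: w}.ncard = n.choose w.length := by
  induction n generalizing a w with
  | zero =>
    cases w with
    | nil =>
      rw [List.length_nil, Nat.choose_self, Set.ncard_eq_one]
      refine ⟨[a], Set.ext fun x => ⟨?_, ?_⟩⟩
      · rintro ⟨hl, hx⟩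
        obtain ⟨b, rfl⟩ := List.length_eq_one_iff.1 hl
        simpa using hx
      · rintro rfl
        simp
    | cons b w =>
      rw [List.length_cons, Nat.choose_zero_succ, Set.ncard_eq_zero (finite_destutter_eq _ _)]
      refine Set.eq_empty_of_forall_notMem ?_
      rintro x ⟨hl, hx⟩
      obtain ⟨c, rfl⟩ := List.length_eq_one_iff.1 hl
      simp at hx
  | succ n ih =>
    have key : {x : List ℕ | x.length = n + 1 + 1 ∧ x.destutter (· ≠ ·) = a :: w} =
        List.cons a '' {x | x.length = n + 1 ∧ x.destutter (· ≠ ·) = a :: w} ∪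
          List.cons a '' {x | x.length = n + 1 ∧ x.destutter (· ≠ ·) = w} := by
      ext x
      constructor
      · rintro ⟨hl, hx⟩
        match x, hl with
        | b :: c :: t, hl =>
          rw [List.destutter_cons_cons] at hx
          split_ifs at hx with hbc
          · obtain ⟨rfl, hx⟩ := List.cons.inj hx
            exact .inr ⟨c :: t, ⟨by simpa using hl, by rwa [List.destutter_cons']⟩, rfl⟩
          · obtain rfl : b = c := not_not.1 hbc
            obtain ⟨l, hl'⟩ := exists_destutter'_eq_cons t b
            obtain rfl : b = a := by
              rw [hx] at hl'
              exact (List.cons.inj hl').1.symm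
            exact .inl ⟨b :: t, ⟨by simpa using hl, by rwa [List.destutter_cons']⟩, rfl⟩
      · rintro (⟨y, ⟨hl, hy⟩, rfl⟩ | ⟨y, ⟨hl, hy⟩, rfl⟩)
        · refine ⟨by simp [hl], ?_⟩
          match y, hl with
          | c :: t, hl =>
            obtain ⟨l, hl'⟩ := exists_destutter'_eq_cons t c
            rw [List.destutter_cons', hl'] at hy
            obtain rfl := (List.cons.inj hy).1
            rw [List.destutter_cons_cons, if_neg (by simp), hl', hy]
        · refine ⟨by simp [hl], ?_⟩
          match y, hl with
          | c :: t, hl =>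
            obtain ⟨l, hl'⟩ := exists_destutter'_eq_cons t c
            rw [List.destutter_cons'] at hy
            rw [hl'] at hy
            subst hy
            rw [List.destutter_cons_cons, if_pos (List.isChain_cons_cons.1 hw).1, hl']
    rw [key, Set.ncard_union_eq ?_ ((finite_destutter_eq _ _).image _)
      ((finite_destutter_eq _ _).image _),
      Set.ncard_image_of_injective _ List.cons_injective,
      Set.ncard_image_of_injective _ List.cons_injective, ih a w hw]
    · cases w with
      | nil =>
        have : {x : List ℕ | x.length = n + 1 ∧ x.destutter (· ≠ ·) = []} = ∅ := by
          refine Set.eq_empty_of_forall_notMem ?_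
          rintro x ⟨hl, hx⟩
          rw [List.destutter_eq_nil] at hx
          simp [hx] at hl
        rw [this, Set.ncard_empty, List.length_nil, Nat.choose_zero_right, Nat.choose_zero_right]
      | cons b w =>
        rw [ih b w hw.tail, List.length_cons, Nat.choose_succ_succ, add_comm]
    · rw [Set.disjoint_left]
      rintro _ ⟨y, ⟨-, hy⟩, rfl⟩ ⟨z, ⟨-, hz⟩, hzy⟩
      obtain rfl := (List.cons.inj hzy).2
      rw [hy] at hz
      exact absurd (congrArg List.length hz) (by simp)

/-- If membership in `V` is insensitive to adjacent repetitions, then the members of `V` are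
counted by the binomial transform of the numbers of members without adjacent repetitions. Here `C k`
is the set of such members of length `k + 1`. -/
theorem ncard_eq_sum_choose_mul_card {V : List ℕ → Prop}
    (hV : ∀ x, V (x.destutter (· ≠ ·)) ↔ V x) (hfin : ∀ n, {x | x.length = n ∧ V x}.Finite)
    (C : ℕ → Finset (List ℕ))
    (hC : ∀ k y, y ∈ C k ↔ y.length = k + 1 ∧ y.IsChain (· ≠ ·) ∧ V y) (n : ℕ) :
    {x | x.length = n + 1 ∧ V x}.ncard = ∑ k ∈ Finset.range (n + 1), n.choose k * (C k).card := by
  classical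
  rw [Set.ncard_eq_toFinset_card _ (hfin _),
    Finset.card_eq_sum_card_fiberwise (f := fun x => x.destutter (· ≠ ·))
      (t := (Finset.range (n + 1)).biUnion C), Finset.sum_biUnion]
  · refine Finset.sum_congr rfl fun k _ => ?_
    rw [mul_comm, ← smul_eq_mul, ← Finset.sum_const]
    refine Finset.sum_congr rfl fun y hy => ?_
    obtain ⟨hl, hch, hVy⟩ := (hC k y).1 hy
    match y, hl with
    | a :: w, hl =>
      have hw : w.length = k := by simpa using hl
      rw [← hw, ← ncard_destutter_eq n a w hch,
        Set.ncard_eq_toFinset_card _ (finite_destutter_eq _ _)]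
      congr 1
      ext x
      simp only [Finset.mem_filter, Set.Finite.mem_toFinset, Set.mem_ofPred_eq]
      constructor
      · rintro ⟨⟨h1, -⟩, h2⟩
        exact ⟨h1, h2⟩
      · rintro ⟨h1, h2⟩
        exact ⟨⟨h1, by rwa [← hV, h2]⟩, h2⟩
  · intro i _ j _ hij
    refine Finset.disjoint_left.2 fun y hi hj => hij ?_
    have h1 := ((hC i y).1 hi).1
    have h2 := ((hC j y).1 hj).1
    omega
  · intro x hx
    obtain ⟨hl, hVx⟩ : x.length = n + 1 ∧ V x := by simpa using hx
    simp only [Finset.coe_biUnion, Finset.coe_range, Set.mem_iUnion]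
    have h1 := (List.destutter_sublist (· ≠ ·) x).length_le
    have h2 : 0 < (x.destutter (· ≠ ·)).length := by
      rw [List.length_pos_iff, Ne, List.destutter_eq_nil]
      rintro rfl
      simp at hl
    refine ⟨(x.destutter (· ≠ ·)).length - 1, by simp only [Set.mem_Iio]; omega, ?_⟩
    exact (hC _ _).2 ⟨by omega, List.isChain_destutter _ _, (hV x).2 hVx⟩

lemma sum_choose_mul_of_eq_two {c : ℕ → ℕ} (h0 : c 0 = 1) (h1 : c 1 = 1)
    (h2 : ∀ k, c (k + 2) = 2) (n : ℕ) :
    ∑ k ∈ Finset.range (n + 1), n.choose k * c k + (n + 1) = 2 ^ (n + 1) := by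
  have hc : ∀ k, n.choose k * c k + ((if k = 0 then 1 else 0) + if k = 1 then n else 0) =
      2 * n.choose k := by
    intro k
    match k with
    | 0 => simp [h0]
    | 1 => simp [h1, two_mul]
    | k + 2 => simp [h2, mul_comm]
  have hs : ∑ k ∈ Finset.range (n + 1), ((if k = 0 then 1 else 0) + if k = 1 then n else 0) =
      n + 1 := by
    rw [Finset.sum_add_distrib, Finset.sum_ite_eq', Finset.sum_ite_eq']
    rcases n with _ | n <;> simp [add_comm]
  calc _ = ∑ k ∈ Finset.range (n + 1),
        (n.choose k * c k + ((if k = 0 then 1 else 0) + if k = 1 then n else 0)) := by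
        rw [Finset.sum_add_distrib, hs]
    _ = 2 ^ (n + 1) := by
        rw [Finset.sum_congr rfl fun k _ => hc k, ← Finset.mul_sum, Nat.sum_range_choose, pow_succ,
          mul_comm]

/-! ### Two branches of words without adjacent repetitions -/

lemma isRGF_range (k : ℕ) : IsRGF (List.range k) := by
  induction k with
  | zero => exact isRGF_nil
  | succ k ih => exact List.range_succ ▸ isRGF_snoc.2 ⟨ih, by simp⟩

lemma isChain_range (k : ℕ) : (List.range k).IsChain (· ≠ ·) :=
  List.nodup_range.isChain

lemma isChain_ne_snoc {x : List ℕ} {l v : ℕ} :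
    (x ++ [l] ++ [v]).IsChain (· ≠ ·) ↔ (x ++ [l]).IsChain (· ≠ ·) ∧ l ≠ v := by
  rw [List.isChain_append]
  simp

lemma RGFAvoids.of_snoc {P : Finset (List ℕ)} {x : List ℕ} {v : ℕ} (h : RGFAvoids P (x ++ [v])) :
    RGFAvoids P x :=
  ⟨(isRGF_snoc.1 h.1).1, fun p hp => (h.2 p hp).of_sublist (List.sublist_append_left _ _)⟩

/-- If no pattern of `P` has an adjacent repetition, and the avoiders without adjacent repetitions
are the words `0 1 ⋯ k` and one further word `w k` for each length `k + 3`, then the number of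
avoiders of length `n` is `2 ^ n - n`. -/
theorem ncard_rgfAvoids_of_two_branches {P : Finset (List ℕ)} (hP : ∀ p ∈ P, p.IsChain (· ≠ ·))
    (hrange : ∀ k, RGFAvoids P (List.range k)) (w : ℕ → List ℕ) (hlen : ∀ k, (w k).length = k + 3)
    (hne : ∀ k, List.range (k + 3) ≠ w k) (hch : ∀ k, (w k).IsChain (· ≠ ·))
    (hw : ∀ k, RGFAvoids P (w k))
    (hstart : ∀ k v, RGFAvoids P (List.range (k + 2) ++ [v]) → v < k + 1 →
      List.range (k + 2) ++ [v] = w k)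
    (hstep : ∀ k v, RGFAvoids P (w k ++ [v]) → (w k ++ [v]).IsChain (· ≠ ·) →
      w k ++ [v] = w (k + 1)) (n : ℕ) :
    {x | x.length = n + 1 ∧ RGFAvoids P x}.ncard + (n + 1) = 2 ^ (n + 1) := by
  have hsnoc : ∀ k v, RGFAvoids P (List.range (k + 1) ++ [v]) →
      (List.range (k + 1) ++ [v]).IsChain (· ≠ ·) → v < k ∨ v = k + 1 := by
    intro k v h hc
    rw [List.range_succ] at hc
    have h1 := (isChain_ne_snoc.1 hc).2
    have h2 := (isRGF_snoc.1 h.1).2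
    by_contra hv
    simpa using h2 (k + 1) (by omega)
  have hone : ∀ y : List ℕ, y.length = 1 → RGFAvoids P y → y = [0] := by
    intro y hl h
    obtain ⟨v, rfl⟩ := List.length_eq_one_iff.1 hl
    rw [h.1.head_eq_zero]
  have htwo : ∀ y : List ℕ, y.length = 2 → y.IsChain (· ≠ ·) → RGFAvoids P y → y = [0, 1] := by
    intro y hl hc h
    rcases List.eq_nil_or_concat y with rfl | ⟨x, v, rfl⟩
    · simp at hl
    rw [List.concat_eq_append] at *
    obtain rfl := hone x (by simpa using hl) h.of_snoc
    rcases hsnoc 0 v h hc with hv | rfl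
    · omega
    · rfl
  have hthree : ∀ k, ∀ y : List ℕ, y.length = k + 3 → y.IsChain (· ≠ ·) → RGFAvoids P y →
      y = List.range (k + 3) ∨ y = w k := by
    intro k
    induction k with
    | zero =>
      intro y hl hc h
      rcases List.eq_nil_or_concat y with rfl | ⟨x, v, rfl⟩
      · simp at hl
      rw [List.concat_eq_append] at *
      obtain rfl := htwo x (by simpa using hl) (List.isChain_append.1 hc).1 h.of_snoc
      rcases hsnoc 1 v h hc with hv | rfl
      · exact .inr (hstart 0 v h hv)
      · exact .inl rfl
    | succ k ih =>
      intro y hl hc h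
      rcases List.eq_nil_or_concat y with rfl | ⟨x, v, rfl⟩
      · simp at hl
      rw [List.concat_eq_append] at *
      rcases ih x (by simpa using hl) (List.isChain_append.1 hc).1 h.of_snoc with rfl | rfl
      · rcases hsnoc (k + 2) v h hc with hv | rfl
        · exact .inr (hstart (k + 1) v h hv)
        · exact .inl List.range_succ.symm
      · exact .inr (hstep k v h hc)
  let C : ℕ → Finset (List ℕ)
    | 0 => {[0]}
    | 1 => {[0, 1]}
    | k + 2 => {List.range (k + 3), w k}
  have hC : ∀ k y, y ∈ C k ↔ y.length = k + 1 ∧ y.IsChain (· ≠ ·) ∧ RGFAvoids P y := by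
    intro k y
    match k with
    | 0 =>
      simp only [C, Finset.mem_singleton]
      exact ⟨by rintro rfl; exact ⟨rfl, isChain_range 1, hrange 1⟩, fun h => hone y h.1 h.2.2⟩
    | 1 =>
      simp only [C, Finset.mem_singleton]
      exact ⟨by rintro rfl; exact ⟨rfl, isChain_range 2, hrange 2⟩,
        fun h => htwo y h.1 h.2.1 h.2.2⟩
    | k + 2 =>
      simp only [C, Finset.mem_insert, Finset.mem_singleton]
      constructor
      · rintro (rfl | rfl)
        · exact ⟨by simp, isChain_range _, hrange _⟩
        · exact ⟨hlen k, hch k, hw k⟩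
      · exact fun h => hthree k y h.1 h.2.1 h.2.2
  rw [ncard_eq_sum_choose_mul_card (fun x => rgfAvoids_destutter hP)
    (fun n => (finite_rgf n).subset fun x hx => ⟨hx.1, hx.2.1⟩) C hC]
  exact sum_choose_mul_of_eq_two rfl rfl (fun k => Finset.card_pair (hne k)) n

lemma rgfAvoids_iff {p q r x : List ℕ} :
    RGFAvoids {p, q, r} x ↔ IsRGF x ∧ Avoids x p ∧ Avoids x q ∧ Avoids x r := by
  simp [RGFAvoids]

lemma IsRGF.triple_sublist {x : List ℕ} {a b c : ℕ} (hx : IsRGF x) (hab : a < b) (hbc : b < c)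
    (hc : c ∈ x) : [a, b, c].Sublist x :=
  hx.cons_sublist hab (hx.cons_sublist hbc (List.singleton_sublist.2 hc))

/-! ### The four pattern sets without `0112` -/

/-- All patterns considered other than `0102` and `0112` end in a letter that occurs earlier in the
pattern, so that they cannot arise by appending a new letter. -/
lemma avoids_snoc_of_notMem {x p : List ℕ} {v : ℕ}
    (hp : p = [0, 1, 0, 1] ∨ p = [0, 1, 2, 0] ∨ p = [0, 1, 2, 1]) (hx : Avoids x p)
    (hv : v ∉ x) : Avoids (x ++ [v]) p := by
  intro h
  rcases hp with rfl | rfl | rfl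
  · obtain ⟨a, b, hab, h⟩ := contains_0101.1 h
    rcases four_sublist_snoc.1 h with h | ⟨rfl, h'⟩
    · exact hx (contains_0101.2 ⟨a, b, hab, h⟩)
    · exact hv (h'.subset (by simp))
  · obtain ⟨a, b, c, hab, hbc, h⟩ := contains_0120.1 h
    rcases four_sublist_snoc.1 h with h | ⟨rfl, h'⟩
    · exact hx (contains_0120.2 ⟨a, b, c, hab, hbc, h⟩)
    · exact hv (h'.subset (by simp))
  · obtain ⟨a, b, c, hab, hbc, h⟩ := contains_0121.1 h
    rcases four_sublist_snoc.1 h with h | ⟨rfl, h'⟩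
    · exact hx (contains_0121.2 ⟨a, b, c, hab, hbc, h⟩)
    · exact hv (h'.subset (by simp))

lemma pairwise_of_sublist_range {w : List ℕ} {k : ℕ} (h : w.Sublist (List.range k)) :
    w.Pairwise (· < ·) :=
  List.pairwise_lt_range.sublist h

lemma avoids_range_0101 (k : ℕ) : Avoids (List.range k) [0, 1, 0, 1] := by
  intro h
  obtain ⟨a, b, hab, h⟩ := contains_0101.1 h
  have := pairwise_of_sublist_range h
  simp at this

lemma avoids_range_0102 (k : ℕ) : Avoids (List.range k) [0, 1, 0, 2] := by
  intro h
  obtain ⟨a, b, c, hab, hbc, h⟩ := contains_0102.1 h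
  have := pairwise_of_sublist_range h
  simp at this

lemma avoids_range_0120 (k : ℕ) : Avoids (List.range k) [0, 1, 2, 0] := by
  intro h
  obtain ⟨a, b, c, hab, hbc, h⟩ := contains_0120.1 h
  have := pairwise_of_sublist_range h
  simp at this

lemma avoids_range_0121 (k : ℕ) : Avoids (List.range k) [0, 1, 2, 1] := by
  intro h
  obtain ⟨a, b, c, hab, hbc, h⟩ := contains_0121.1 h
  have := pairwise_of_sublist_range h
  simp at this

/-- A word `0 1 ⋯ (k - 1) v` avoids `0101`: in an occurrence, the second `0` would belong to the
increasing part. -/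
lemma avoids_range_snoc_0101 (k v : ℕ) : Avoids (List.range k ++ [v]) [0, 1, 0, 1] := by
  intro h
  obtain ⟨a, b, hab, h⟩ := contains_0101.1 h
  rcases four_sublist_snoc.1 h with h' | ⟨rfl, h'⟩ <;>
  · have := pairwise_of_sublist_range h'
    simp at this

lemma avoids_range_snoc_0102 (k v : ℕ) : Avoids (List.range k ++ [v]) [0, 1, 0, 2] := by
  intro h
  obtain ⟨a, b, c, hab, hbc, h⟩ := contains_0102.1 h
  rcases four_sublist_snoc.1 h with h' | ⟨rfl, h'⟩ <;>
  · have := pairwise_of_sublist_range h'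
    simp at this

lemma isChain_range_snoc {k v : ℕ} (hv : v ≠ k) :
    (List.range (k + 1) ++ [v]).IsChain (· ≠ ·) := by
  rw [List.range_succ, isChain_ne_snoc, ← List.range_succ]
  exact ⟨isChain_range _, hv.symm⟩

lemma range_ne_range_snoc {k v : ℕ} (hv : v ≠ k) : List.range (k + 1) ≠ List.range k ++ [v] := by
  rw [List.range_succ]
  intro h
  simp at h
  exact hv h.symm

lemma isRGF_range_snoc {k v : ℕ} (hv : v ≤ k) : IsRGF (List.range k ++ [v]) :=
  isRGF_snoc.2 ⟨isRGF_range k, fun j hj => List.mem_range.2 (by omega)⟩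

/-- The second branch consists of the words `0 1 ⋯ (k + 1) k`. -/
theorem ncard_rgfAvoids_0101_0102_0120 (n : ℕ) :
    {x | x.length = n + 1 ∧
      RGFAvoids {[0, 1, 0, 1], [0, 1, 0, 2], [0, 1, 2, 0]} x}.ncard + (n + 1) = 2 ^ (n + 1) := by
  refine ncard_rgfAvoids_of_two_branches (by simp)
    (fun k => rgfAvoids_iff.2 ⟨isRGF_range k, avoids_range_0101 k, avoids_range_0102 k,
      avoids_range_0120 k⟩)
    (fun k => List.range (k + 2) ++ [k]) (fun k => by simp)
    (fun k => range_ne_range_snoc (by omega)) (fun k => isChain_range_snoc (by omega))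
    (fun k => rgfAvoids_iff.2 ⟨isRGF_range_snoc (by omega), avoids_range_snoc_0101 _ _,
      avoids_range_snoc_0102 _ _, fun h => ?_⟩) ?_ ?_ n
  · obtain ⟨a, b, c, hab, hbc, h⟩ := contains_0120.1 h
    rcases four_sublist_snoc.1 h with h | ⟨rfl, h⟩
    · have := pairwise_of_sublist_range h
      simp at this
    · have := List.mem_range.1 (h.subset (show c ∈ [a, b, c] by simp))
      omega
  · intro k v h hv
    obtain ⟨-, -, -, h3⟩ := rgfAvoids_iff.1 h
    rcases (Nat.lt_succ_iff.1 hv).lt_or_eq with hlt | rfl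
    · refine absurd (contains_0120.2 ⟨v, v + 1, v + 2, by omega, by omega,
        four_sublist_snoc.2 (.inr ⟨rfl, ?_⟩)⟩) h3
      exact (isRGF_range _).triple_sublist (by omega) (by omega) (List.mem_range.2 (by omega))
    · rfl
  · intro k v h hc
    obtain ⟨hr, h1, h2, h3⟩ := rgfAvoids_iff.1 h
    have hkv : k ≠ v := (isChain_ne_snoc.1 hc).2
    have hr' := isRGF_range (k + 2)
    have hdesc : [k, k + 1, k].Sublist (List.range (k + 2) ++ [k]) :=
      three_sublist_snoc.2 (.inr ⟨rfl, hr'.cons_sublist (by omega)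
        (List.singleton_sublist.2 (by simp))⟩)
    exfalso
    rcases lt_trichotomy v (k + 1) with hlt | rfl | hlt
    · refine h3 (contains_0120.2 ⟨v, k, k + 1, by omega, by omega,
        four_sublist_snoc.2 (.inr ⟨rfl, ?_⟩)⟩)
      exact (hr'.triple_sublist (by omega) (by omega) (by simp)).trans
        (List.sublist_append_left _ _)
    · exact h1 (contains_0101.2 ⟨k, k + 1, by omega, four_sublist_snoc.2 (.inr ⟨rfl, hdesc⟩)⟩)
    · exact h2 (contains_0102.2 ⟨k, k + 1, v, by omega, by omega,
        four_sublist_snoc.2 (.inr ⟨rfl, hdesc⟩)⟩)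

/-- The second branch consists of the words `0 1 ⋯ (k + 1) 0`. -/
theorem ncard_rgfAvoids_0101_0102_0121 (n : ℕ) :
    {x | x.length = n + 1 ∧
      RGFAvoids {[0, 1, 0, 1], [0, 1, 0, 2], [0, 1, 2, 1]} x}.ncard + (n + 1) = 2 ^ (n + 1) := by
  refine ncard_rgfAvoids_of_two_branches (by simp)
    (fun k => rgfAvoids_iff.2 ⟨isRGF_range k, avoids_range_0101 k, avoids_range_0102 k,
      avoids_range_0121 k⟩)
    (fun k => List.range (k + 2) ++ [0]) (fun k => by simp)
    (fun k => range_ne_range_snoc (by omega)) (fun k => isChain_range_snoc (by omega))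
    (fun k => rgfAvoids_iff.2 ⟨isRGF_range_snoc (by omega), avoids_range_snoc_0101 _ _,
      avoids_range_snoc_0102 _ _, fun h => ?_⟩) ?_ ?_ n
  · obtain ⟨a, b, c, hab, hbc, h⟩ := contains_0121.1 h
    rcases four_sublist_snoc.1 h with h | ⟨rfl, h⟩
    · have := pairwise_of_sublist_range h
      simp at this
    · omega
  · intro k v h hv
    obtain ⟨-, -, -, h3⟩ := rgfAvoids_iff.1 h
    rcases Nat.eq_zero_or_pos v with rfl | hpos
    · rfl
    · refine absurd (contains_0121.2 ⟨0, v, v + 1, by omega, by omega,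
        four_sublist_snoc.2 (.inr ⟨rfl, ?_⟩)⟩) h3
      exact (isRGF_range _).triple_sublist (by omega) (by omega) (List.mem_range.2 (by omega))
  · intro k v h hc
    obtain ⟨hr, h1, h2, h3⟩ := rgfAvoids_iff.1 h
    have hv : 0 ≠ v := (isChain_ne_snoc.1 hc).2
    have hdesc : [0, 1, 0].Sublist (List.range (k + 2) ++ [0]) :=
      three_sublist_snoc.2 (.inr ⟨rfl, (isRGF_range _).cons_sublist (by omega)
        (List.singleton_sublist.2 (by simp))⟩)
    exfalso
    rcases (show 1 ≤ v by omega).eq_or_lt with rfl | hlt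
    · exact h1 (contains_0101.2 ⟨0, 1, by omega, four_sublist_snoc.2 (.inr ⟨rfl, hdesc⟩)⟩)
    · exact h2 (contains_0102.2 ⟨0, 1, v, by omega, by omega,
        four_sublist_snoc.2 (.inr ⟨rfl, hdesc⟩)⟩)

/-- If `0120` and `0121` are avoided, then `0 1 ⋯ (k + 1)` can only be followed by a letter smaller
than `k + 1` when `k = 0`, so that the branching happens at `01`. -/
lemma eq_of_rgfAvoids_range_snoc {k v : ℕ} (h3 : Avoids (List.range (k + 2) ++ [v]) [0, 1, 2, 0])
    (h4 : Avoids (List.range (k + 2) ++ [v]) [0, 1, 2, 1]) (hv : v < k + 1) : k = 0 ∧ v = 0 := by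
  have hr := isRGF_range (k + 2)
  have hv0 : v = 0 := by
    by_contra hpos
    refine h4 (contains_0121.2 ⟨0, v, v + 1, by omega, by omega,
      four_sublist_snoc.2 (.inr ⟨rfl, ?_⟩)⟩)
    exact hr.triple_sublist (by omega) (by omega) (List.mem_range.2 (by omega))
  refine ⟨?_, hv0⟩
  by_contra hk
  refine h3 (contains_0120.2 ⟨v, 1, 2, by omega, by omega,
    four_sublist_snoc.2 (.inr ⟨rfl, ?_⟩)⟩)
  exact hr.triple_sublist (by omega) (by omega) (List.mem_range.2 (by omega))

lemma avoids_of_length_lt {x p : List ℕ} (h : x.length < p.length) : Avoids x p := by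
  rintro ⟨w, hw, rfl⟩
  have := hw.length_le
  simp only [red, List.length_map] at h
  omega

/-- The second branch consists of the words `0 1 0 2 3 ⋯ (k + 1)`. -/
theorem ncard_rgfAvoids_0101_0120_0121 (n : ℕ) :
    {x | x.length = n + 1 ∧
      RGFAvoids {[0, 1, 0, 1], [0, 1, 2, 0], [0, 1, 2, 1]} x}.ncard + (n + 1) = 2 ^ (n + 1) := by
  have hsucc : ∀ k, [0, 1, 0] ++ List.range' 2 (k + 1) =
      [0, 1, 0] ++ List.range' 2 k ++ [k + 2] := by
    intro k
    rw [List.range'_1_concat, List.append_assoc, add_comm]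
  have hmem : ∀ k v, v ∈ [0, 1, 0] ++ List.range' 2 k ↔ v < k + 2 := by
    intro k v
    simp only [List.mem_append, List.mem_cons, List.not_mem_nil, or_false, List.mem_range'_1]
    omega
  have hnew : ∀ k, k + 2 ∉ [0, 1, 0] ++ List.range' 2 k := fun k h => absurd ((hmem _ _).1 h) (lt_irrefl _)
  have hw : ∀ k, RGFAvoids {[0, 1, 0, 1], [0, 1, 2, 0], [0, 1, 2, 1]}
      ([0, 1, 0] ++ List.range' 2 k) := by
    intro k
    rw [rgfAvoids_iff]
    induction k with
    | zero =>
      exact ⟨isRGF_range_snoc (k := 2) (v := 0) (by omega), avoids_of_length_lt (by simp),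
        avoids_of_length_lt (by simp), avoids_of_length_lt (by simp)⟩
    | succ k ih =>
      rw [hsucc]
      exact ⟨isRGF_snoc.2 ⟨ih.1, fun j hj => (hmem k j).2 hj⟩,
        avoids_snoc_of_notMem (by simp) ih.2.1 (hnew k),
        avoids_snoc_of_notMem (by simp) ih.2.2.1 (hnew k),
        avoids_snoc_of_notMem (by simp) ih.2.2.2 (hnew k)⟩
  refine ncard_rgfAvoids_of_two_branches (by simp)
    (fun k => rgfAvoids_iff.2 ⟨isRGF_range k, avoids_range_0101 k, avoids_range_0120 k,
      avoids_range_0121 k⟩)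
    (fun k => [0, 1, 0] ++ List.range' 2 k) (fun k => by simp)
    (fun k h => ?_) (fun k => ?_) hw ?_ ?_ n
  · have h2 := (hmem k (k + 2)).1 (h ▸ List.mem_range.2 (by omega))
    omega
  · induction k with
    | zero => simp
    | succ k ih =>
      rw [hsucc, List.isChain_append]
      refine ⟨ih, by simp, fun a ha b hb hab => hnew k ?_⟩
      simp only [List.head?_cons, Option.mem_def, Option.some.injEq] at hb
      subst hb
      exact hab ▸ List.mem_of_mem_getLast? ha
  · intro k v h hv
    obtain ⟨-, -, h2, h3⟩ := rgfAvoids_iff.1 h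
    obtain ⟨rfl, rfl⟩ := eq_of_rgfAvoids_range_snoc h2 h3 hv
    rfl
  · intro k v h hc
    obtain ⟨hr, h1, h2, h3⟩ := rgfAvoids_iff.1 h
    have hrk := (isRGF_snoc.1 hr).1
    have hle : v ≤ k + 2 := by
      by_contra hlt
      exact hnew k ((isRGF_snoc.1 hr).2 (k + 2) (by omega))
    rcases hle.eq_or_lt with rfl | hlt
    · exact (hsucc k).symm
    exfalso
    match k, v with
    | 0, 0 => simp at hc
    | k, 1 =>
      exact h1 (contains_0101.2 ⟨0, 1, by omega, four_sublist_snoc.2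
        (.inr ⟨rfl, List.sublist_append_left _ _⟩)⟩)
    | k + 1, 0 =>
      exact h2 (contains_0120.2 ⟨0, 1, 2, by omega, by omega, four_sublist_snoc.2
        (.inr ⟨rfl, hrk.triple_sublist (by omega) (by omega) ((hmem _ _).2 (by omega))⟩)⟩)
    | k + 1, v + 2 =>
      have hv : k + 2 ≠ v + 2 := by
        rw [hsucc] at hc
        exact (isChain_ne_snoc.1 hc).2
      exact h3 (contains_0121.2 ⟨0, v + 2, v + 3, by omega, by omega, four_sublist_snoc.2
        (.inr ⟨rfl, hrk.triple_sublist (by omega) (by omega) ((hmem _ _).2 (by omega))⟩)⟩)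

/-- The second branch consists of the alternating words `0 1 0 1 ⋯`. -/
theorem ncard_rgfAvoids_0102_0120_0121 (n : ℕ) :
    {x | x.length = n + 1 ∧
      RGFAvoids {[0, 1, 0, 2], [0, 1, 2, 0], [0, 1, 2, 1]} x}.ncard + (n + 1) = 2 ^ (n + 1) := by
  have hsucc : ∀ k, (List.range (k + 1)).map (· % 2) = (List.range k).map (· % 2) ++ [k % 2] := by
    intro k
    simp [List.range_succ]
  have hlt : ∀ k, ∀ v ∈ (List.range k).map (· % 2), v < 2 := by
    intro k v hv
    obtain ⟨i, -, rfl⟩ := List.mem_map.1 hv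
    exact Nat.mod_lt _ (by omega)
  have hr : ∀ k, IsRGF ((List.range k).map (· % 2)) := by
    intro k
    induction k with
    | zero => exact isRGF_nil
    | succ k ih =>
      rw [hsucc]
      refine isRGF_snoc.2 ⟨ih, fun j hj => List.mem_map.2 ⟨0, List.mem_range.2 ?_, ?_⟩⟩ <;> omega
  refine ncard_rgfAvoids_of_two_branches (by simp)
    (fun k => rgfAvoids_iff.2 ⟨isRGF_range k, avoids_range_0102 k, avoids_range_0120 k,
      avoids_range_0121 k⟩)
    (fun k => (List.range (k + 3)).map (· % 2)) (fun k => by simp)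
    (fun k h => ?_) (fun k => ?_) (fun k => rgfAvoids_iff.2 ⟨hr _, ?_, ?_, ?_⟩) ?_ ?_ n
  · have := hlt (k + 3) 2 (h ▸ List.mem_range.2 (by omega))
    omega
  · generalize k + 3 = m
    induction m with
    | zero => simp
    | succ m ih =>
      rcases m with _ | m
      · simp
      · rw [hsucc, hsucc, isChain_ne_snoc, ← hsucc]
        exact ⟨ih, by omega⟩
  · intro h
    obtain ⟨a, b, c, hab, hbc, h⟩ := contains_0102.1 h
    have := hlt _ c (h.subset (by simp))
    omega
  · intro h
    obtain ⟨a, b, c, hab, hbc, h⟩ := contains_0120.1 h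
    have := hlt _ c (h.subset (by simp))
    omega
  · intro h
    obtain ⟨a, b, c, hab, hbc, h⟩ := contains_0121.1 h
    have := hlt _ c (h.subset (by simp))
    omega
  · intro k v h hv
    obtain ⟨-, -, h2, h3⟩ := rgfAvoids_iff.1 h
    obtain ⟨rfl, rfl⟩ := eq_of_rgfAvoids_range_snoc h2 h3 hv
    rfl
  · intro k v h hc
    obtain ⟨hr, h1, -, -⟩ := rgfAvoids_iff.1 h
    have hle : v < 2 := by
      by_contra hge
      rcases (not_lt.1 hge).eq_or_lt with rfl | hlt2
      · refine h1 (contains_0102.2 ⟨0, 1, 2, by omega, by omega, four_sublist_snoc.2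
          (.inr ⟨rfl, ?_⟩)⟩)
        exact (List.range_sublist.2 (show 3 ≤ k + 3 by omega)).map (· % 2)
      · exact absurd (hlt _ _ ((isRGF_snoc.1 hr).2 2 hlt2)) (by omega)
    rw [hsucc (k + 2)] at hc
    have hne : (k + 2) % 2 ≠ v := (isChain_ne_snoc.1 hc).2
    rw [hsucc (k + 3), show v = (k + 3) % 2 by omega]

/-! ### The pattern set `0101`, `0102`, `0112` -/

lemma append_singleton_injective (g : List ℕ → ℕ) :
    Function.Injective fun x : List ℕ => x ++ [g x] :=
  fun _ _ h => (List.append_inj' h rfl).1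

lemma length_one_and_isRGF_iff {x : List ℕ} : x.length = 0 + 1 ∧ IsRGF x ↔ x = [0] := by
  constructor
  · rintro ⟨hl, h⟩
    obtain ⟨v, rfl⟩ := List.length_eq_one_iff.1 hl
    rw [h.head_eq_zero]
  · rintro rfl
    exact ⟨rfl, isRGF_range 1⟩

lemma setOf_length_one_eq {p : List ℕ → Prop} (hp : ∀ x, p x → IsRGF x) (h0 : p [0]) :
    {x : List ℕ | x.length = 0 + 1 ∧ p x} = {[0]} := by
  ext x
  refine ⟨fun h => length_one_and_isRGF_iff.1 ⟨h.1, hp x h.2⟩, ?_⟩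
  rintro rfl
  exact ⟨rfl, h0⟩

lemma exists_eq_snoc {x : List ℕ} {n : ℕ} (h : x.length = n + 1) :
    ∃ y v, y.length = n ∧ x = y ++ [v] := by
  rcases List.eq_nil_or_concat x with rfl | ⟨y, v, rfl⟩
  · simp at h
  · exact ⟨y, v, by simpa using h, List.concat_eq_append⟩

lemma IsRGF.snoc_zero {x : List ℕ} (h : IsRGF x) : IsRGF (x ++ [0]) :=
  isRGF_snoc.2 ⟨h, by simp⟩

/-- Restricted growth functions avoiding the pattern `001`. -/
def RGFAvoids001 (x : List ℕ) : Prop :=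
  IsRGF x ∧ ∀ a b, a < b → ¬ [a, a, b].Sublist x

/-- Such a word of length at least two either ends in `0`, which may be removed, or has its only `0`
in front, which may be removed before decreasing all the other letters. -/
lemma setOf_rgfAvoids001_succ (n : ℕ) :
    {x | x.length = n + 1 + 1 ∧ RGFAvoids001 x} =
      (fun x => x ++ [0]) '' {x | x.length = n + 1 ∧ RGFAvoids001 x} ∪
        (fun x => 0 :: x.map Nat.succ) '' {x | x.length = n + 1 ∧ RGFAvoids001 x} := by
  ext x
  constructor
  · rintro ⟨hl, hr, h⟩
    obtain ⟨y, v, hy, rfl⟩ := exists_eq_snoc hl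
    rcases Nat.eq_zero_or_pos v with rfl | hv
    · refine .inl ⟨y, ⟨hy, (isRGF_snoc.1 hr).1, fun a b hab hs => h a b hab ?_⟩, rfl⟩
      exact hs.trans (List.sublist_append_left _ _)
    · right
      match y, hy with
      | c :: z, hy =>
        obtain rfl : c = 0 := IsRGF.head_eq_zero hr
        have hz : ∀ u ∈ z ++ [v], u ≠ 0 := by
          rintro u hu rfl
          have huz : 0 ∈ z := by simpa [hv.ne] using hu
          exact h 0 v hv ((two_sublist_snoc.2 (.inr ⟨rfl, huz⟩)).cons_cons 0)
        have hmap : ((z ++ [v]).map Nat.pred).map Nat.succ = z ++ [v] := by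
          rw [List.map_map]
          exact (List.map_congr_left fun u hu => Nat.succ_pred (hz u hu)).trans (List.map_id _)
        refine ⟨(z ++ [v]).map Nat.pred, ⟨by simpa using hy, ?_, fun a b hab hs => ?_⟩, ?_⟩
        · rw [← isRGF_zero_cons_map_succ, hmap]
          exact hr
        · refine h (a + 1) (b + 1) (by omega) (List.Sublist.cons _ ?_)
          have := hs.map Nat.succ
          rwa [hmap] at this
        · simp only [hmap, List.cons_append]
  · rintro (⟨y, ⟨hl, hr, h⟩, rfl⟩ | ⟨y, ⟨hl, hr, h⟩, rfl⟩)
    · refine ⟨by simp [hl], hr.snoc_zero, fun a b hab hs => ?_⟩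
      rcases three_sublist_snoc.1 hs with hs | ⟨rfl, -⟩
      · exact h a b hab hs
      · omega
    · refine ⟨by simp [hl], isRGF_zero_cons_map_succ.2 hr, fun a b hab hs => ?_⟩
      cases hs with
      | cons _ hs =>
        obtain ⟨w, hw, he⟩ := List.sublist_map_iff.1 hs
        match w, he with
        | [p, q, r], he =>
          simp only [List.map_cons, List.map_nil, List.cons.injEq, and_true] at he
          obtain ⟨rfl, hq, rfl⟩ := he
          obtain rfl := Nat.succ_injective hq
          exact h _ _ (by omega) hw
      | cons_cons _ hs => simpa using hs.subset (show 0 ∈ [0, b] by simp)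

lemma finite_rgfAvoids001 (n : ℕ) : {x | x.length = n ∧ RGFAvoids001 x}.Finite :=
  (finite_rgf n).subset fun _ hx => ⟨hx.1, hx.2.1⟩

lemma ncard_rgfAvoids001 (n : ℕ) : {x | x.length = n + 1 ∧ RGFAvoids001 x}.ncard = 2 ^ n := by
  induction n with
  | zero =>
    rw [setOf_length_one_eq (fun x hx => hx.1), Set.ncard_singleton, pow_zero]
    refine ⟨isRGF_range 1, fun a b hab h => ?_⟩
    simpa using h.length_le
  | succ n ih =>
    rw [setOf_rgfAvoids001_succ, Set.ncard_union_eq ?_ ((finite_rgfAvoids001 _).image _)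
      ((finite_rgfAvoids001 _).image _),
      Set.ncard_image_of_injective _ (append_singleton_injective fun _ => 0),
      Set.ncard_image_of_injective _ ?_, ih, pow_succ, mul_two]
    · exact List.cons_injective.comp (List.map_injective_iff.2 Nat.succ_injective)
    · rw [Set.disjoint_left]
      rintro _ ⟨y, ⟨hl, -⟩, rfl⟩ ⟨z, -, hz⟩
      match y, hl with
      | c :: y, _ =>
        have h2 : z.map Nat.succ = y ++ [0] := (List.cons.inj hz).2
        have h0 : 0 ∈ z.map Nat.succ := by simp [h2]
        simp at h0

lemma sublist_cons_of_ne {a b c : ℕ} {w l : List ℕ} (hab : a ≠ b)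
    (h : (a :: b :: w).Sublist (c :: c :: l)) : (a :: b :: w).Sublist (c :: l) := by
  cases h with
  | cons _ h => exact h
  | cons_cons _ h =>
    cases h with
    | cons _ h => exact h.cons_cons _
    | cons_cons _ h => exact absurd rfl hab

/-- Once the leading zeros are reduced to one, the nonconstant avoiders are exactly the nonconstant
restricted growth functions avoiding `001`. -/
lemma setOf_rgfAvoids_0101_0102_0112_succ (n : ℕ) :
    {x | x.length = n + 1 + 1 ∧ RGFAvoids {[0, 1, 0, 1], [0, 1, 0, 2], [0, 1, 1, 2]} x} =
      List.cons 0 '' {x | x.length = n + 1 ∧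
        RGFAvoids {[0, 1, 0, 1], [0, 1, 0, 2], [0, 1, 1, 2]} x} ∪
      ({x | x.length = n + 1 + 1 ∧ RGFAvoids001 x} \ {List.replicate (n + 1 + 1) 0}) := by
  ext x
  constructor
  · rintro ⟨hl, h⟩
    obtain ⟨hr, h1, h2, h3⟩ := rgfAvoids_iff.1 h
    match x, hl with
    | z :: c :: t, hl =>
      obtain rfl := hr.head_eq_zero
      have hc : c = 0 ∨ c = 1 := by
        by_contra hc
        simpa using hr [0] c t rfl 1 (by omega)
      rcases hc with rfl | rfl
      · refine .inl ⟨0 :: t, ⟨by simpa using hl, rgfAvoids_iff.2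
          ⟨isRGF_zero_cons_zero_cons.1 hr, ?_, ?_, ?_⟩⟩, rfl⟩
        · exact h1.of_sublist (List.sublist_cons_self _ _)
        · exact h2.of_sublist (List.sublist_cons_self _ _)
        · exact h3.of_sublist (List.sublist_cons_self _ _)
      · refine .inr ⟨⟨hl, hr, fun a b hab hs => ?_⟩, fun he => ?_⟩
        · rcases Nat.eq_zero_or_pos a with rfl | ha
          · have hs' : [0, b].Sublist (1 :: t) := by
              cases hs with
              | cons _ hs => exact (List.sublist_cons_self _ _).trans hs
              | cons_cons _ hs => exact hs
            have ht : [0, b].Sublist t := by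
              cases hs' with
              | cons _ hs => exact hs
            have hx : [0, 1, 0, b].Sublist (0 :: 1 :: t) := (ht.cons_cons 1).cons_cons 0
            rcases (show 1 ≤ b by omega).eq_or_lt with rfl | hb
            · exact h1 (contains_0101.2 ⟨0, 1, by omega, hx⟩)
            · exact h2 (contains_0102.2 ⟨0, 1, b, by omega, hb, hx⟩)
          · exact h3 (contains_0112.2 ⟨0, a, b, ha, hab, hr.cons_sublist ha hs⟩)
        · have : 1 ∈ List.replicate (n + 1 + 1) 0 := he ▸ (by simp)
          simp at this
  · rintro (⟨y, ⟨hl, h⟩, rfl⟩ | ⟨⟨hl, hr, h⟩, -⟩)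
    · obtain ⟨hr, h1, h2, h3⟩ := rgfAvoids_iff.1 h
      match y, hl with
      | z :: t, hl =>
        obtain rfl := hr.head_eq_zero
        refine ⟨by simpa using hl, rgfAvoids_iff.2
          ⟨isRGF_zero_cons_zero_cons.2 hr, fun hc => ?_, fun hc => ?_, fun hc => ?_⟩⟩
        · obtain ⟨a, b, hab, hs⟩ := contains_0101.1 hc
          exact h1 (contains_0101.2 ⟨a, b, hab, sublist_cons_of_ne hab.ne hs⟩)
        · obtain ⟨a, b, c, hab, hbc, hs⟩ := contains_0102.1 hc
          exact h2 (contains_0102.2 ⟨a, b, c, hab, hbc, sublist_cons_of_ne hab.ne hs⟩)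
        · obtain ⟨a, b, c, hab, hbc, hs⟩ := contains_0112.1 hc
          exact h3 (contains_0112.2 ⟨a, b, c, hab, hbc, sublist_cons_of_ne hab.ne hs⟩)
    · refine ⟨hl, rgfAvoids_iff.2 ⟨hr, fun hc => ?_, fun hc => ?_, fun hc => ?_⟩⟩
      · obtain ⟨a, b, hab, hs⟩ := contains_0101.1 hc
        exact h a b hab (((List.sublist_cons_self b [a, b]).cons_cons a).trans hs)
      · obtain ⟨a, b, c, hab, hbc, hs⟩ := contains_0102.1 hc
        exact h a c (hab.trans hbc) (((List.sublist_cons_self b [a, c]).cons_cons a).trans hs)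
      · obtain ⟨a, b, c, hab, hbc, hs⟩ := contains_0112.1 hc
        exact h b c hbc ((List.sublist_cons_self a [b, b, c]).trans hs)

lemma finite_rgfAvoids (P : Finset (List ℕ)) (n : ℕ) :
    {x | x.length = n ∧ RGFAvoids P x}.Finite :=
  (finite_rgf n).subset fun _ hx => ⟨hx.1, hx.2.1⟩

lemma add_succ_eq_two_pow_of_recurrence {f : ℕ → ℕ} (h0 : f 0 = 1)
    (h : ∀ n, f (n + 1) + 1 = f n + 2 ^ (n + 1)) (n : ℕ) : f n + (n + 1) = 2 ^ (n + 1) := by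
  induction n with
  | zero => simp [h0]
  | succ n ih =>
    have := h n
    rw [pow_succ 2 (n + 1)]
    omega

lemma rgfAvoids_zero {p q r : List ℕ} (hp : 1 < p.length) (hq : 1 < q.length)
    (hr : 1 < r.length) : RGFAvoids {p, q, r} [0] :=
  rgfAvoids_iff.2 ⟨isRGF_range 1, avoids_of_length_lt hp, avoids_of_length_lt hq,
    avoids_of_length_lt hr⟩

theorem ncard_rgfAvoids_0101_0102_0112 (n : ℕ) :
    {x | x.length = n + 1 ∧
      RGFAvoids {[0, 1, 0, 1], [0, 1, 0, 2], [0, 1, 1, 2]} x}.ncard + (n + 1) = 2 ^ (n + 1) := by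
  refine add_succ_eq_two_pow_of_recurrence (f := fun n => {x | x.length = n + 1 ∧
      RGFAvoids {[0, 1, 0, 1], [0, 1, 0, 2], [0, 1, 1, 2]} x}.ncard) ?_ (fun n => ?_) n
  · rw [setOf_length_one_eq (fun x hx => hx.1) (rgfAvoids_zero (by simp) (by simp) (by simp)),
      Set.ncard_singleton]
  · have hmem : List.replicate (n + 1 + 1) 0 ∈
        {x | x.length = n + 1 + 1 ∧ RGFAvoids001 x} := by
      refine ⟨List.length_replicate, fun u v t h j hj => ?_, fun a b hab h => ?_⟩
      · have hv : v ∈ List.replicate (n + 1 + 1) 0 := h ▸ (by simp)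
        rw [List.eq_of_mem_replicate hv] at hj
        omega
      · rw [List.eq_of_mem_replicate (h.subset (show b ∈ [a, a, b] by simp))] at hab
        omega
    rw [setOf_rgfAvoids_0101_0102_0112_succ, Set.ncard_union_eq ?_ ((finite_rgfAvoids _ _).image _)
      ((finite_rgfAvoids001 _).sdiff), Set.ncard_image_of_injective _ List.cons_injective, add_assoc,
      Set.ncard_sdiff_singleton_add_one hmem (finite_rgfAvoids001 _), ncard_rgfAvoids001]
    rw [Set.disjoint_left]
    rintro _ ⟨y, ⟨hl, h⟩, rfl⟩ ⟨⟨-, -, h'⟩, hne⟩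
    match y, hl with
    | z :: t, hl =>
      obtain rfl := h.1.head_eq_zero
      refine hne (List.eq_replicate_iff.2 ⟨by simpa using hl, fun b hb => ?_⟩)
      by_contra hb0
      have hbt : b ∈ t := by simpa [hb0] using hb
      exact h' 0 b (by omega) (((List.singleton_sublist.2 hbt).cons_cons 0).cons_cons 0)

/-! ### The pattern set `0101`, `0112`, `0121` -/

lemma IsRGF.mem_iff_lt_card {x : List ℕ} (hx : IsRGF x) (v : ℕ) :
    v ∈ x ↔ v < x.toFinset.card := by
  have h : ∃ k, x.toFinset = Finset.range k := by
    induction x using List.reverseRecOn with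
    | nil => exact ⟨0, rfl⟩
    | append_singleton x w ih =>
      obtain ⟨hx', hw⟩ := isRGF_snoc.1 hx
      obtain ⟨k, hk⟩ := ih hx'
      have hk' : ∀ v, v ∈ x ↔ v < k := fun v => by rw [← List.mem_toFinset, hk, Finset.mem_range]
      refine ⟨max k (w + 1), Finset.ext fun v => ?_⟩
      have h1 := fun hv : v < w => (hk' v).1 (hw v hv)
      simp only [List.mem_toFinset, List.mem_append, List.mem_singleton, Finset.mem_range, hk']
      omega
  obtain ⟨k, hk⟩ := h
  rw [← List.mem_toFinset, hk, Finset.card_range, Finset.mem_range]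

lemma IsRGF.eq_card_of_notMem {x : List ℕ} {v : ℕ} (hx : IsRGF (x ++ [v])) (hv : v ∉ x) :
    v = x.toFinset.card := by
  obtain ⟨hx', hw⟩ := isRGF_snoc.1 hx
  rw [hx'.mem_iff_lt_card] at hv
  refine (not_lt.1 hv).antisymm' (not_lt.1 fun hlt => ?_)
  exact absurd ((hx'.mem_iff_lt_card _).1 (hw _ hlt)) (lt_irrefl _)

lemma IsRGF.snoc_card {x : List ℕ} (hx : IsRGF x) : IsRGF (x ++ [x.toFinset.card]) :=
  isRGF_snoc.2 ⟨hx, fun j hj => (hx.mem_iff_lt_card j).2 hj⟩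

lemma IsRGF.card_notMem {x : List ℕ} (hx : IsRGF x) : x.toFinset.card ∉ x := by
  simp [hx.mem_iff_lt_card]

/-- Restricted growth functions in which no positive letter is repeated. -/
def RGFNodupPos (x : List ℕ) : Prop :=
  IsRGF x ∧ ∀ b, 0 < b → ¬ [b, b].Sublist x

lemma setOf_rgfNodupPos_succ (n : ℕ) :
    {x | x.length = n + 1 + 1 ∧ RGFNodupPos x} =
      (fun x => x ++ [0]) '' {x | x.length = n + 1 ∧ RGFNodupPos x} ∪
        (fun x => x ++ [x.toFinset.card]) '' {x | x.length = n + 1 ∧ RGFNodupPos x} := by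
  ext x
  constructor
  · rintro ⟨hl, hr, h⟩
    obtain ⟨y, v, hy, rfl⟩ := exists_eq_snoc hl
    have hF : RGFNodupPos y := ⟨(isRGF_snoc.1 hr).1, fun b hb hs =>
      h b hb (hs.trans (List.sublist_append_left _ _))⟩
    rcases Nat.eq_zero_or_pos v with rfl | hv
    · exact .inl ⟨y, ⟨hy, hF⟩, rfl⟩
    · have hvy : v ∉ y := fun hvy => h v hv (two_sublist_snoc.2 (.inr ⟨rfl, hvy⟩))
      exact .inr ⟨y, ⟨hy, hF⟩, by rw [hr.eq_card_of_notMem hvy]⟩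
  · rintro (⟨y, ⟨hl, hr, h⟩, rfl⟩ | ⟨y, ⟨hl, hr, h⟩, rfl⟩)
    · refine ⟨by simp [hl], hr.snoc_zero, fun b hb hs => ?_⟩
      rcases two_sublist_snoc.1 hs with hs | ⟨rfl, -⟩
      · exact h b hb hs
      · omega
    · refine ⟨by simp [hl], hr.snoc_card, fun b hb hs => ?_⟩
      rcases two_sublist_snoc.1 hs with hs | ⟨rfl, hs⟩
      · exact h b hb hs
      · exact hr.card_notMem hs

lemma finite_rgfNodupPos (n : ℕ) : {x | x.length = n ∧ RGFNodupPos x}.Finite :=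
  (finite_rgf n).subset fun _ hx => ⟨hx.1, hx.2.1⟩

lemma card_toFinset_pos_of_length {x : List ℕ} {n : ℕ} (h : x.length = n + 1) :
    0 < x.toFinset.card := by
  rw [Finset.card_pos, List.toFinset_nonempty_iff]
  rintro rfl
  simp at h

lemma ncard_rgfNodupPos (n : ℕ) : {x | x.length = n + 1 ∧ RGFNodupPos x}.ncard = 2 ^ n := by
  induction n with
  | zero =>
    rw [setOf_length_one_eq (fun x hx => hx.1), Set.ncard_singleton, pow_zero]
    refine ⟨isRGF_range 1, fun b hb h => ?_⟩
    simpa using h.length_le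
  | succ n ih =>
    rw [setOf_rgfNodupPos_succ, Set.ncard_union_eq ?_ ((finite_rgfNodupPos _).image _)
      ((finite_rgfNodupPos _).image _),
      Set.ncard_image_of_injective _ (append_singleton_injective fun _ => 0),
      Set.ncard_image_of_injective _ (append_singleton_injective fun x => x.toFinset.card), ih,
      pow_succ, mul_two]
    rw [Set.disjoint_left]
    rintro _ ⟨y, -, rfl⟩ ⟨z, ⟨hl, -⟩, hz⟩
    have hpos := card_toFinset_pos_of_length hl
    have h0 : z.toFinset.card = 0 := (List.cons.inj (List.append_inj' hz rfl).2).1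
    omega

lemma four_sublist_snoc_of_ne {x : List ℕ} {a b c d v : ℕ} (hcd : c ≠ d)
    (h : [a, b, c, d].Sublist (x ++ [v] ++ [v])) : [a, b, c, d].Sublist (x ++ [v]) := by
  rcases four_sublist_snoc.1 h with h | ⟨rfl, h⟩
  · exact h
  · rcases three_sublist_snoc.1 h with h | ⟨rfl, -⟩
    · exact four_sublist_snoc.2 (.inr ⟨rfl, h⟩)
    · exact absurd rfl hcd

/-- The avoiders of `0101`, `0112` and `0121` that do not end in `0`. -/
def posAvoiders (n : ℕ) : Set (List ℕ) :=
  {x | x.length = n ∧ RGFAvoids {[0, 1, 0, 1], [0, 1, 1, 2], [0, 1, 2, 1]} x ∧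
    ∃ y v, 0 < v ∧ x = y ++ [v]}

lemma finite_posAvoiders (n : ℕ) : (posAvoiders n).Finite :=
  (finite_rgf n).subset fun _ hx => ⟨hx.1, hx.2.1.1⟩

/-- The last letter of an avoider not ending in `0` either repeats the letter before it or is new;
in the latter case no positive letter occurs twice before it, because of `0112`. -/
lemma posAvoiders_succ (n : ℕ) :
    posAvoiders (n + 1 + 1) = (fun x => x ++ [x.getLastD 0]) '' posAvoiders (n + 1) ∪
      (fun x => x ++ [x.toFinset.card]) '' {x | x.length = n + 1 ∧ RGFNodupPos x} := by
  ext x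
  constructor
  · rintro ⟨hl, h, y, v, hv, rfl⟩
    obtain ⟨hr, h1, h2, h3⟩ := rgfAvoids_iff.1 h
    have hry := (isRGF_snoc.1 hr).1
    have hy : y.length = n + 1 := by simpa using hl
    by_cases hvy : v ∈ y
    · left
      obtain ⟨z, l, hz, rfl⟩ := exists_eq_snoc hy
      rcases lt_trichotomy l v with hlt | rfl | hlt
      · exfalso
        have hvz : v ∈ z := by simpa [hlt.ne'] using hvy
        exact h1 (contains_0101.2 ⟨l, v, hlt, four_sublist_snoc.2 (.inr ⟨rfl,
          hry.cons_sublist hlt (two_sublist_snoc.2 (.inr ⟨rfl, hvz⟩))⟩)⟩)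
      · exact ⟨z ++ [l], ⟨hy, h.of_snoc, z, l, hv, rfl⟩, by simp⟩
      · exfalso
        have hvz : v ∈ z := by simpa [hlt.ne] using hvy
        exact h3 (contains_0121.2 ⟨0, v, l, hv, hlt, four_sublist_snoc.2 (.inr ⟨rfl,
          hry.cons_sublist hv (two_sublist_snoc.2 (.inr ⟨rfl, hvz⟩))⟩)⟩)
    · right
      refine ⟨y, ⟨hy, hry, fun b hb hs => ?_⟩, by rw [hr.eq_card_of_notMem hvy]⟩
      have hby : b ∈ y := hs.subset (by simp)
      have hbv : b < v := by
        rcases lt_trichotomy b v with hlt | rfl | hlt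
        · exact hlt
        · exact absurd hby hvy
        · exact absurd (hry.mem_of_lt hlt hby) hvy
      exact h2 (contains_0112.2 ⟨0, b, v, hb, hbv, four_sublist_snoc.2 (.inr ⟨rfl,
        hry.cons_sublist hb hs⟩)⟩)
  · rintro (⟨_, ⟨hl, h, y, v, hv, rfl⟩, rfl⟩ | ⟨y, ⟨hl, hr, h⟩, rfl⟩)
    · obtain ⟨hr, h1, h2, h3⟩ := rgfAvoids_iff.1 h
      have hlast : (y ++ [v]).getLastD 0 = v := by simp
      simp only [hlast]
      refine ⟨by simpa using hl, rgfAvoids_iff.2 ⟨isRGF_snoc.2 ⟨hr, fun j hj => ?_⟩,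
        fun hc => ?_, fun hc => ?_, fun hc => ?_⟩, _, v, hv, rfl⟩
      · exact List.mem_append_left _ ((isRGF_snoc.1 hr).2 j hj)
      · obtain ⟨a, b, hab, hs⟩ := contains_0101.1 hc
        exact h1 (contains_0101.2 ⟨a, b, hab, four_sublist_snoc_of_ne hab.ne hs⟩)
      · obtain ⟨a, b, c, hab, hbc, hs⟩ := contains_0112.1 hc
        exact h2 (contains_0112.2 ⟨a, b, c, hab, hbc, four_sublist_snoc_of_ne hbc.ne hs⟩)
      · obtain ⟨a, b, c, hab, hbc, hs⟩ := contains_0121.1 hc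
        exact h3 (contains_0121.2 ⟨a, b, c, hab, hbc, four_sublist_snoc_of_ne hbc.ne' hs⟩)
    · refine ⟨by simp [hl], rgfAvoids_iff.2 ⟨hr.snoc_card,
        avoids_snoc_of_notMem (by simp) (fun hc => ?_) hr.card_notMem, fun hc => ?_,
        avoids_snoc_of_notMem (by simp) (fun hc => ?_) hr.card_notMem⟩, y, _,
        card_toFinset_pos_of_length hl, rfl⟩
      · obtain ⟨a, b, hab, hs⟩ := contains_0101.1 hc
        refine h b (by omega) (List.Sublist.trans ?_ hs)
        exact ((List.sublist_cons_self a [b]).cons_cons b).cons a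
      · obtain ⟨a, b, c, hab, hbc, hs⟩ := contains_0112.1 hc
        refine h b (by omega) ((List.sublist_cons_self a [b, b]).trans ?_)
        rcases four_sublist_snoc.1 hs with hs | ⟨-, hs⟩
        · exact (List.sublist_append_left [a, b, b] [c]).trans hs
        · exact hs
      · obtain ⟨a, b, c, hab, hbc, hs⟩ := contains_0121.1 hc
        refine h b (by omega) (List.Sublist.trans ?_ hs)
        exact ((List.sublist_cons_self c [b]).cons_cons b).cons a

lemma ncard_posAvoiders (n : ℕ) : (posAvoiders (n + 1)).ncard + 1 = 2 ^ n := by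
  induction n with
  | zero =>
    have : posAvoiders (0 + 1) = ∅ := by
      refine Set.eq_empty_of_forall_notMem ?_
      rintro _ ⟨hl, h, y, v, hv, rfl⟩
      have := length_one_and_isRGF_iff.1 ⟨hl, h.1⟩
      obtain rfl : y = [] := by simpa using hl
      simp at this
      omega
    simp [this]
  | succ n ih =>
    rw [posAvoiders_succ, Set.ncard_union_eq ?_ ((finite_posAvoiders _).image _)
      ((finite_rgfNodupPos _).image _),
      Set.ncard_image_of_injective _ (append_singleton_injective fun x => x.getLastD 0),
      Set.ncard_image_of_injective _ (append_singleton_injective fun x => x.toFinset.card),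
      ncard_rgfNodupPos, pow_succ, add_right_comm, ih, mul_two]
    rw [Set.disjoint_left]
    rintro _ ⟨_, ⟨-, -, y, v, -, rfl⟩, rfl⟩ ⟨z, ⟨-, hz, -⟩, h⟩
    obtain ⟨rfl, h⟩ := List.append_inj' h rfl
    refine hz.card_notMem ?_
    rw [(List.cons.inj h).1]
    simp

lemma setOf_rgfAvoids_0101_0112_0121_succ (n : ℕ) :
    {x | x.length = n + 1 + 1 ∧ RGFAvoids {[0, 1, 0, 1], [0, 1, 1, 2], [0, 1, 2, 1]} x} =
      (fun x => x ++ [0]) '' {x | x.length = n + 1 ∧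
        RGFAvoids {[0, 1, 0, 1], [0, 1, 1, 2], [0, 1, 2, 1]} x} ∪ posAvoiders (n + 1 + 1) := by
  ext x
  constructor
  · rintro ⟨hl, h⟩
    obtain ⟨y, v, hy, rfl⟩ := exists_eq_snoc hl
    rcases Nat.eq_zero_or_pos v with rfl | hv
    · exact .inl ⟨y, ⟨hy, h.of_snoc⟩, rfl⟩
    · exact .inr ⟨hl, h, y, v, hv, rfl⟩
  · rintro (⟨y, ⟨hl, h⟩, rfl⟩ | ⟨hl, h, -⟩)
    · obtain ⟨hr, h1, h2, h3⟩ := rgfAvoids_iff.1 h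
      refine ⟨by simp [hl], rgfAvoids_iff.2 ⟨hr.snoc_zero, fun hc => ?_, fun hc => ?_,
        fun hc => ?_⟩⟩
      · obtain ⟨a, b, hab, hs⟩ := contains_0101.1 hc
        rcases four_sublist_snoc.1 hs with hs | ⟨rfl, -⟩
        · exact h1 (contains_0101.2 ⟨a, b, hab, hs⟩)
        · omega
      · obtain ⟨a, b, c, hab, hbc, hs⟩ := contains_0112.1 hc
        rcases four_sublist_snoc.1 hs with hs | ⟨rfl, -⟩
        · exact h2 (contains_0112.2 ⟨a, b, c, hab, hbc, hs⟩)
        · omega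
      · obtain ⟨a, b, c, hab, hbc, hs⟩ := contains_0121.1 hc
        rcases four_sublist_snoc.1 hs with hs | ⟨rfl, -⟩
        · exact h3 (contains_0121.2 ⟨a, b, c, hab, hbc, hs⟩)
        · omega
    · exact ⟨hl, h⟩

theorem ncard_rgfAvoids_0101_0112_0121 (n : ℕ) :
    {x | x.length = n + 1 ∧
      RGFAvoids {[0, 1, 0, 1], [0, 1, 1, 2], [0, 1, 2, 1]} x}.ncard + (n + 1) = 2 ^ (n + 1) := by
  refine add_succ_eq_two_pow_of_recurrence (f := fun n => {x | x.length = n + 1 ∧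
      RGFAvoids {[0, 1, 0, 1], [0, 1, 1, 2], [0, 1, 2, 1]} x}.ncard) ?_ (fun n => ?_) n
  · rw [setOf_length_one_eq (fun x hx => hx.1) (rgfAvoids_zero (by simp) (by simp) (by simp)),
      Set.ncard_singleton]
  · rw [setOf_rgfAvoids_0101_0112_0121_succ, Set.ncard_union_eq ?_ ((finite_rgfAvoids _ _).image _)
      (finite_posAvoiders _), Set.ncard_image_of_injective _ (append_singleton_injective fun _ => 0),
      add_assoc, ncard_posAvoiders]
    rw [Set.disjoint_left]
    rintro _ ⟨y, -, rfl⟩ ⟨-, -, z, v, hv, h⟩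
    have := (List.append_inj' h rfl).2
    simp at this
    omega

/-! ### Conclusion -/

lemma numAvoiders_eq {P : Finset (List ℕ)} (hP : [0, 1, 0, 1] ∈ P ∨ [0, 1, 0, 2] ∈ P) {n : ℕ}
    (hn : 1 ≤ n)
    (h : ∀ m, {x | x.length = m + 1 ∧ RGFAvoids P x}.ncard + (m + 1) = 2 ^ (m + 1)) :
    (numAvoiders P n : ℤ) = 2 ^ n - n := by
  obtain ⟨m, rfl⟩ : ∃ m, n = m + 1 := ⟨n - 1, by omega⟩
  rw [numAvoiders, avoiders_eq hP, eq_sub_iff_add_eq]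
  exact_mod_cast h m

end AscentSeq

theorem mainTheorem6 (n : ℕ) (hn : 1 ≤ n) :
    (AscentSeq.numAvoiders {[0, 1, 0, 1], [0, 1, 0, 2], [0, 1, 1, 2]} n : ℤ) = 2 ^ n - n ∧
    (AscentSeq.numAvoiders {[0, 1, 0, 1], [0, 1, 0, 2], [0, 1, 2, 0]} n : ℤ) = 2 ^ n - n ∧
    (AscentSeq.numAvoiders {[0, 1, 0, 1], [0, 1, 0, 2], [0, 1, 2, 1]} n : ℤ) = 2 ^ n - n ∧
    (AscentSeq.numAvoiders {[0, 1, 0, 1], [0, 1, 1, 2], [0, 1, 2, 1]} n : ℤ) = 2 ^ n - n ∧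
    (AscentSeq.numAvoiders {[0, 1, 0, 1], [0, 1, 2, 0], [0, 1, 2, 1]} n : ℤ) = 2 ^ n - n ∧
    (AscentSeq.numAvoiders {[0, 1, 0, 2], [0, 1, 2, 0], [0, 1, 2, 1]} n : ℤ) = 2 ^ n - n :=
  ⟨AscentSeq.numAvoiders_eq (by simp) hn AscentSeq.ncard_rgfAvoids_0101_0102_0112,
    AscentSeq.numAvoiders_eq (by simp) hn AscentSeq.ncard_rgfAvoids_0101_0102_0120,
    AscentSeq.numAvoiders_eq (by simp) hn AscentSeq.ncard_rgfAvoids_0101_0102_0121,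
    AscentSeq.numAvoiders_eq (by simp) hn AscentSeq.ncard_rgfAvoids_0101_0112_0121,
    AscentSeq.numAvoiders_eq (by simp) hn AscentSeq.ncard_rgfAvoids_0101_0120_0121,
    AscentSeq.numAvoiders_eq (by simp) hn AscentSeq.ncard_rgfAvoids_0102_0120_0121⟩
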